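/- All groups are finite, and classes of groups are closed under isomorphism. A formation is a non-empty class of groups closed under homomorphic images and subdirect products. For a formation $\mathfrak F$, the residual $G^{\mathfrak F}$ is the smallest normal subgroup $N$ of $G$ with $G/N\in\mathfrak F$, and for a class of groups $\mathfrak X$ the class $\mathfrak X\circ\mathfrak F$ consists of all groups $G$ with $G^{\mathfrak F}\in\mathfrak X$. Let $\pi$ be a set of primes, $\pi'$ its complement in the set of all primes, $\mathfrak N$ the class of nilpotent groups, and $\mathfrak S_\pi$ the class of $\pi$-solvable groups, that is, groups each of whose chief factors is a $\pi'$-group or a $p$-group for some $p\in\pi$. Let $O_{\pi'}(G)$ be the largest normal $\pi'$-subgroup of $G$. The $\pi'\mathfrak F$-norm of $G$ is $\mathcal N_{\pi'\mathfrak F}(G)=\bigcap_{H\le G}N_G(H^{\mathfrak F}O_{\pi'}(G))$. Put $\mathcal N^0_{\pi'\mathfrak F}(G)=1$ and $\mathcal N^{i}_{\pi'\mathfrak F}(G)/\mathcal N^{i-1}_{\pi'\mathfrak F}(G)=\mathcal N_{\pi'\mathfrak F}(G/\mathcal N^{i-1}_{\pi'\mathfrak F}(G))$ for $i\ge 1$,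 and let $\mathcal N^\infty_{\pi'\mathfrak F}(G)$ be the terminal term of this ascending series. For a formation $\mathfrak M$, a chief factor $L/K$ of $G$ is $\mathfrak M$-central in $G$ if $(L/K)\rtimes(G/C_G(L/K))\in\mathfrak M$. A normal subgroup $N$ of $G$ is $\pi\mathfrak M$-hypercentral in $G$ if every chief factor of $G$ below $N$ of order divisible by at least one prime in $\pi$ is $\mathfrak M$-central in $G$ (in particular, $N=1$ is). The $\pi\mathfrak M$-hypercentre $Z_{\pi\mathfrak M}(G)$ is the product of all $\pi\mathfrak M$-hypercentral normal subgroups of $G$. Theorem. Let $\mathfrak F$ be a formation that is closed under taking subgroups, and let $\pi$ be a set of primes. Then $\mathcal N^\infty_{\pi'\mathfrak F}(G)=Z_{\pi(\mathfrak N\circ\mathfrak F)}(G)$ for every group $G\in\mathfrak S_\pi\circ\mathfrak F$. -/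

import Mathlib

universe u

/-- A class of finite groups: a property of groups that is invariant under isomorphism
and only holds for finite groups. -/
structure GroupClass where
  /-- `X.Mem G` says that the group `G` belongs to the class `X`. -/
  Mem : ∀ (G : Type u) [Group G], Prop
  finite : ∀ {G : Type u} [Group G], Mem G → Finite G
  iso : ∀ {G H : Type u} [Group G] [Group H], G ≃* H → Mem G → Mem H

namespace GroupClass

/-- A formation: a non-empty class of finite groups, closed under homomorphic images and under
subdirect products. The homomorphisms `f`, `g` in `subdirect` exhibit `G` as a
subdirect product of `H` and `K`, i.e. as a subgroup of `H × K` projecting onto both factors. -/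
structure IsFormation (F : GroupClass.{u}) : Prop where
  nonempty : ∃ (G : Type u) (_ : Group G), F.Mem G
  image : ∀ {G H : Type u} [Group G] [Group H] (f : G →* H),
    Function.Surjective f → F.Mem G → F.Mem H
  subdirect : ∀ {G H K : Type u} [Group G] [Group H] [Group K] (f : G →* H) (g : G →* K),
    Function.Surjective f → Function.Surjective g → Function.Injective (f.prod g) →
    F.Mem H → F.Mem K → F.Mem G

/-- The class `F` is closed under taking subgroups. -/
def IsSubgroupClosed (F : GroupClass.{u}) : Prop :=
  ∀ {G : Type u} [Group G] (H : Subgroup G), F.Mem G → F.Mem H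

/-- The `F`-residual of `G`: the intersection of all normal subgroups `N` with `G ⧸ N` in `F`.
If `F` is a formation and `G` is finite, this is the smallest normal subgroup with
quotient in `F`. -/
def residual (F : GroupClass.{u}) (G : Type u) [Group G] : Subgroup G :=
  sInf {N : Subgroup G | ∃ _ : N.Normal, F.Mem (G ⧸ N)}

/-- The `X`-radical of `G`: the product of all normal subgroups of `G` that belong to `X`.
If `X` is a Fitting class and `G` is finite, this is the largest normal `X`-subgroup. -/
def radical (X : GroupClass.{u}) (G : Type u) [Group G] : Subgroup G :=
  sSup {N : Subgroup G | N.Normal ∧ X.Mem N}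

theorem residual_map_le (F : GroupClass.{u}) {G H : Type u} [Group G] [Group H] (e : G ≃* H) :
    (F.residual G).map e.toMonoidHom ≤ F.residual H := by
  refine le_sInf ?_
  rintro N ⟨hN, hF⟩
  rw [Subgroup.map_le_iff_le_comap]
  refine sInf_le ⟨inferInstance, F.iso ?_ hF⟩
  refine (QuotientGroup.congr _ _ e ?_).symm
  exact Subgroup.map_comap_eq_self_of_surjective e.surjective N

theorem residual_map (F : GroupClass.{u}) {G H : Type u} [Group G] [Group H] (e : G ≃* H) :
    (F.residual G).map e.toMonoidHom = F.residual H := by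
  refine le_antisymm (F.residual_map_le e) ?_
  intro x hx
  exact ⟨e.symm x, F.residual_map_le e.symm ⟨x, hx, rfl⟩, e.apply_symm_apply x⟩

theorem radical_normal (X : GroupClass.{u}) (G : Type u) [Group G] : (X.radical G).Normal := by
  exact Subgroup.sSup_normal _ fun _ h => h.1

/-- The formation product `X ∘ F`: all finite groups whose `F`-residual belongs to `X`. -/
def formationProduct (X F : GroupClass.{u}) : GroupClass.{u} where
  Mem G _ := Finite G ∧ X.Mem (F.residual G)
  finite h := h.1
  iso e h := by
    have := h.1
    refine ⟨Finite.of_equiv _ e.toEquiv, X.iso ?_ h.2⟩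
    exact (e.subgroupMap _).trans (MulEquiv.subgroupCongr (F.residual_map e))

/-- The class of finite nilpotent groups. -/
def nilpotent : GroupClass.{u} where
  Mem G _ := Finite G ∧ Group.IsNilpotent G
  finite h := h.1
  iso e h := by
    have := h.1
    have := h.2
    exact ⟨Finite.of_equiv _ e.toEquiv, Group.nilpotent_of_mulEquiv e⟩

end GroupClass

/-- All prime divisors of `n` lie in the set of primes `π`. -/
def IsPiNumber (π : Set Nat.Primes) (n : ℕ) : Prop :=
  ∀ p : Nat.Primes, (p : ℕ) ∣ n → p ∈ π

/-- `L / K` is a chief factor of `G`: `K < L` are normal subgroups of `G` and no normal subgroup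
of `G` lies strictly between them. -/
structure IsChiefFactor {G : Type u} [Group G] (K L : Subgroup G) : Prop where
  bot_normal : K.Normal
  top_normal : L.Normal
  lt : K < L
  eq_or_eq : ∀ N : Subgroup G, N.Normal → K ≤ N → N ≤ L → N = K ∨ N = L

theorem IsChiefFactor.comap {G H : Type u} [Group G] [Group H] (e : G ≃* H) {K L : Subgroup H}
    (h : IsChiefFactor K L) :
    IsChiefFactor (K.comap e.toMonoidHom) (L.comap e.toMonoidHom) := by
  have h1 := h.bot_normal
  have h2 := h.top_normal
  have hs : Function.Surjective e.toMonoidHom := e.surjective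
  refine ⟨inferInstance, inferInstance, (Subgroup.comap_lt_comap_of_surjective hs).2 h.lt, ?_⟩
  intro N hN hKN hNL
  have hc : (N.map e.toMonoidHom).comap e.toMonoidHom = N :=
    Subgroup.comap_map_eq_self_of_injective e.injective N
  rw [← hc] at hKN hNL
  rw [Subgroup.comap_le_comap_of_surjective hs] at hKN hNL
  rcases h.eq_or_eq _ (hN.map _ hs) hKN hNL with h' | h'
  · left; rw [← h', hc]
  · right; rw [← h', hc]

namespace GroupClass

/-- The class of finite `π`-groups. -/
def piGroups (π : Set Nat.Primes) : GroupClass.{u} where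
  Mem G _ := Finite G ∧ IsPiNumber π (Nat.card G)
  finite h := h.1
  iso e h := by
    have := h.1
    exact ⟨Finite.of_equiv _ e.toEquiv, Nat.card_congr e.toEquiv ▸ h.2⟩

/-- The class of finite `π`-solvable groups: every chief factor is a `π'`-group or
a `p`-group for some prime `p ∈ π`. -/
def piSolvable (π : Set Nat.Primes) : GroupClass.{u} where
  Mem G _ := Finite G ∧ ∀ K L : Subgroup G, IsChiefFactor K L →
    IsPiNumber πᶜ (K.relIndex L) ∨ ∃ p ∈ π, ∃ n : ℕ, K.relIndex L = (p : ℕ) ^ n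
  finite h := h.1
  iso e h := by
    have := h.1
    refine ⟨Finite.of_equiv _ e.toEquiv, fun K L hKL => ?_⟩
    have := h.2 _ _ (hKL.comap e)
    rwa [Subgroup.relIndex_comap,
      Subgroup.map_comap_eq_self_of_surjective (f := e.toMonoidHom) e.surjective] at this

end GroupClass

/-- The `X`-`F`-norm of `G`: the intersection, over all subgroups `H` of `G`, of the normalizers
in `G` of the products of the `F`-residual of `H` and the `X`-radical of `G`. -/
def classNorm (X F : GroupClass.{u}) (G : Type u) [Group G] : Subgroup G :=
  ⨅ H : Subgroup G, Subgroup.normalizer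
    (((F.residual H).map H.subtype ⊔ X.radical G : Subgroup G) : Set G)

theorem classNorm_normal (X F : GroupClass.{u}) (G : Type u) [Group G] :
    (classNorm X F G).Normal := by
  refine ⟨fun x hx g => ?_⟩
  have := X.radical_normal G
  rw [classNorm, Subgroup.mem_iInf] at hx ⊢
  intro H
  have key : ((F.residual H).map H.subtype ⊔ X.radical G).map (MulAut.conj g⁻¹ : G →* G)
      = (F.residual (H.map (MulAut.conj g⁻¹ : G →* G))).map
          (H.map (MulAut.conj g⁻¹ : G →* G)).subtype ⊔ X.radical G := by
    have h2 : F.residual (H.map (MulAut.conj g⁻¹ : G →* G)) =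
        (F.residual H).map ((MulAut.conj g⁻¹).subgroupMap H).toMonoidHom :=
      (F.residual_map ((MulAut.conj g⁻¹).subgroupMap H)).symm
    have h3 : (X.radical G).map (MulAut.conj g⁻¹ : G →* G) = X.radical G :=
      Subgroup.Normal.map_conj_eq _ g⁻¹
    rw [Subgroup.map_sup, h2, h3, Subgroup.map_map, Subgroup.map_map]
    rfl
  have h1 := hx (H.map (MulAut.conj g⁻¹ : G →* G))
  rw [← key] at h1
  replace h1 := (Subgroup.map_equiv_normalizer_eq _ (MulAut.conj g⁻¹)).ge h1
  obtain ⟨y, hy, hyx⟩ := h1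
  have : y = g * x * g⁻¹ := by
    rw [← hyx]
    simp [mul_assoc]
  exact this ▸ hy

/-- The ascending series of normal subgroups of `G` that starts with `1` and whose `(i+1)`-st term
is the preimage in `G` of the `X`-`F`-norm of the quotient of `G` by the `i`-th term. -/
def classNormSeriesAux (X F : GroupClass.{u}) (G : Type u) [Group G] :
    ℕ → {N : Subgroup G // N.Normal}
  | 0 => ⟨⊥, inferInstance⟩
  | i + 1 =>
    let N := classNormSeriesAux X F G i
    have : N.1.Normal := N.2
    ⟨(classNorm X F (G ⧸ N.1)).comap (QuotientGroup.mk' N.1),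
      (classNorm_normal X F (G ⧸ N.1)).comap (QuotientGroup.mk' N.1)⟩

/-- The `i`-th term of the ascending series of iterated `X`-`F`-norms of `G`. -/
def classNormSeries (X F : GroupClass.{u}) (G : Type u) [Group G] (i : ℕ) : Subgroup G :=
  (classNormSeriesAux X F G i).1

/-- The terminal term of the series of iterated `X`-`F`-norms of a finite group: the series is
ascending, so its terminal term is the supremum of all its terms. -/
def classNormInfty (X F : GroupClass.{u}) (G : Type u) [Group G] : Subgroup G :=
  ⨆ i : ℕ, classNormSeries X F G i

/-- The terminal term of the series of iterated `πF`-norms of `G`; the `πF`-norm is the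
`X`-`F`-norm for `X` the class of all finite `π`-groups. -/
def piNormInfty (π : Set Nat.Primes) (F : GroupClass.{u}) (G : Type u) [Group G] : Subgroup G :=
  classNormInfty (GroupClass.piGroups π) F G

section Hypercentre

variable {G : Type u} [Group G]

/-- For normal subgroups `K ≤ L` of `G`, the group `L / K` as a subgroup of `G ⧸ K`. -/
def factorSubgroup (K L : Subgroup G) [K.Normal] : Subgroup (G ⧸ K) :=
  L.map (QuotientGroup.mk' K)

instance factorSubgroup_normal (K L : Subgroup G) [K.Normal] [L.Normal] : (factorSubgroup K L).Normal :=
  QuotientGroup.map_normal K L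

/-- The action of `G` on `L / K` by conjugation. Its kernel is the centralizer `C_G(L / K)`. -/
def factorAction (K L : Subgroup G) [K.Normal] [L.Normal] : G →* MulAut (factorSubgroup K L) :=
  MulAut.conjNormal.comp (QuotientGroup.mk' K)

/-- The factor `L / K` is `F`-central in `G`: the semidirect product of `L / K` and
`G / C_G(L / K)`, acting by conjugation, belongs to `F`. -/
def IsFactorCentral (F : GroupClass.{u}) (K L : Subgroup G) [K.Normal] [L.Normal] : Prop :=
  F.Mem (factorSubgroup K L ⋊[QuotientGroup.kerLift (factorAction K L)] (G ⧸ (factorAction K L).ker))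

/-- The normal subgroup `N` of `G` is `πF`-hypercentral in `G`: every chief factor of `G` below `N`
of order divisible by at least one prime in `π` is `F`-central in `G`. (There is no chief factor
below `N = 1`.) -/
def IsPiHypercentral (π : Set Nat.Primes) (F : GroupClass.{u}) (N : Subgroup G) : Prop :=
  N.Normal ∧ ∀ (K L : Subgroup G) [K.Normal] [L.Normal], IsChiefFactor K L → L ≤ N →
    (∃ p ∈ π, (p : ℕ) ∣ Nat.card (factorSubgroup K L)) → IsFactorCentral F K L

end Hypercentre

/-- The `πF`-hypercentre of `G`: the product of all `πF`-hypercentral normal subgroups of `G`. -/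
def piHypercentre (π : Set Nat.Primes) (F : GroupClass.{u}) (G : Type u) [Group G] : Subgroup G :=
  sSup {N : Subgroup G | IsPiHypercentral π F N}

open scoped commutatorElement

/-! ### Residuals of subgroup-closed formations -/

namespace GroupClass

variable {F : GroupClass.{u}} {G H : Type u} [Group G] [Group H]

/-! Write D for the residual of G. Centrality has a usable form: a chief factor L/K is central with
respect to 𝔑 ∘ 𝔉 exactly when [D, L] ≤ K (`isFactorCentral_iff`, resting on
`semidirectProduct_mem_iff`). Both inclusions are then statements about which chief factors D
centralizes.

Hypercentre inside the norm series (`IsPiHypercentral.le_classNormInfty`): let M be the terminal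
term. If a hypercentral N were not inside M, a minimal normal subgroup L of G with L ≤ N and L not
inside M would give a chief factor L/(M ∩ L). Either it is a π'-group, or D centralizes it. In both
cases the image of L lies in the norm of G/M, which is trivial modulo M since the series has
stopped.

Norm series inside the hypercentre: after passing to quotients, everything reduces to a minimal
normal subgroup R inside the norm with order divisible by some p ∈ π (`commutator_residual_eq_bot`).
If D does not centralize R, then R ≤ D is a p-group. Put C = C_D(R) and take a chief factor T/C with
T ≤ D; it is a p'-group, since a p-group would act trivially on R. A Frattini argument
(`exists_supplement_normalizing`) gives K with KC = G normalizing a p'-subgroup V with VC = T. With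
O the π'-radical, KO ∩ R centralizes V and C, hence T, so it is trivial. As R normalizes the product
of O and the residual of K, commutators of R with that residual lie in KO ∩ R = 1. Thus the residual
of K and C both centralize R, and together they cover D, a contradiction. -/

theorem IsFormation.mem_quotient_inf (hF : F.IsFormation) {M N : Subgroup G} [M.Normal] [N.Normal]
    (hM : F.Mem (G ⧸ M)) (hN : F.Mem (G ⧸ N)) : F.Mem (G ⧸ M ⊓ N) := by
  refine hF.subdirect (QuotientGroup.map (M ⊓ N) M (MonoidHom.id G) inf_le_left)
    (QuotientGroup.map (M ⊓ N) N (MonoidHom.id G) inf_le_right) ?_ ?_ ?_ hM hN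
  · exact QuotientGroup.map_surjective_of_surjective _ _ _ (QuotientGroup.mk_surjective (s := M)) _
  · exact QuotientGroup.map_surjective_of_surjective _ _ _ (QuotientGroup.mk_surjective (s := N)) _
  · rw [injective_iff_map_eq_one]
    intro x
    induction x using QuotientGroup.induction_on with
    | H x =>
      intro h
      have h1 := congrArg Prod.fst h
      have h2 := congrArg Prod.snd h
      rw [QuotientGroup.eq_one_iff]
      exact ⟨(QuotientGroup.eq_one_iff x).1 h1, (QuotientGroup.eq_one_iff x).1 h2⟩

theorem IsFormation.mem_of_subsingleton (hF : F.IsFormation) [Subsingleton G] : F.Mem G := by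
  obtain ⟨K, _, hK⟩ := hF.nonempty
  exact hF.image (1 : K →* G) (fun x => ⟨1, Subsingleton.elim _ _⟩) hK

/-- The defining family is closed under intersection, so by finiteness a minimal member lies in all
the others. -/
theorem IsFormation.residual_mem_aux [Finite G] (hF : F.IsFormation) :
    F.residual G ∈ {N : Subgroup G | ∃ _ : N.Normal, F.Mem (G ⧸ N)} := by
  set S := {N : Subgroup G | ∃ _ : N.Normal, F.Mem (G ⧸ N)} with hS
  have hne : S.Nonempty := ⟨⊤, inferInstance,
    have := QuotientGroup.subsingleton_quotient_top (G := G)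
    hF.mem_of_subsingleton⟩
  obtain ⟨N, hN⟩ := S.toFinite.exists_minimal hne
  have : F.residual G = N := by
    refine le_antisymm (sInf_le hN.1) (le_sInf fun M hM => ?_)
    obtain ⟨hn, h1⟩ := hN.1
    obtain ⟨hm, h2⟩ := hM
    have h3 : N ⊓ M ∈ S := ⟨inferInstance, hF.mem_quotient_inf h1 h2⟩
    exact (hN.2 h3 inf_le_left).trans inf_le_right
  rw [this]
  exact hN.1

theorem IsFormation.residual_normal [Finite G] (hF : F.IsFormation) : (F.residual G).Normal :=
  hF.residual_mem_aux.1

theorem IsFormation.mem_quotient_of_residual_le [Finite G] (hF : F.IsFormation) {N : Subgroup G}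
    [N.Normal] (h : F.residual G ≤ N) : F.Mem (G ⧸ N) := by
  obtain ⟨hn, h1⟩ := hF.residual_mem_aux (G := G)
  exact hF.image (QuotientGroup.map (F.residual G) N (MonoidHom.id G) h)
    (QuotientGroup.map_surjective_of_surjective _ _ _ (QuotientGroup.mk_surjective (s := N)) _) h1

theorem residual_le_of_mem_quotient {N : Subgroup G} [N.Normal] (h : F.Mem (G ⧸ N)) :
    F.residual G ≤ N :=
  sInf_le ⟨inferInstance, h⟩

theorem IsFormation.residual_eq_bot_iff [Finite G] (hF : F.IsFormation) :
    F.residual G = ⊥ ↔ F.Mem G := by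
  constructor
  · intro h
    exact F.iso QuotientGroup.quotientBot (hF.mem_quotient_of_residual_le h.le)
  · intro h
    exact le_bot_iff.1 (residual_le_of_mem_quotient (F.iso QuotientGroup.quotientBot.symm h))

/-- The quotient of `G` by the preimage of the residual of `H` embeds in a quotient of `H` lying in
`F`; this is where subgroup closure enters. -/
theorem IsFormation.residual_map_le [Finite H] (hF : F.IsFormation) (hS : F.IsSubgroupClosed)
    (f : G →* H) : (F.residual G).map f ≤ F.residual H := by
  have := hF.residual_normal (G := H)
  rw [Subgroup.map_le_iff_le_comap]
  have hk : (F.residual H).comap f = ((QuotientGroup.mk' (F.residual H)).comp f).ker := by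
    ext x
    simp [MonoidHom.mem_ker]
  rw [hk]
  refine residual_le_of_mem_quotient (F.iso (QuotientGroup.quotientKerEquivRange _).symm ?_)
  exact hS _ (hF.mem_quotient_of_residual_le le_rfl)

theorem IsFormation.residual_map_of_surjective [Finite G] [Finite H] (hF : F.IsFormation)
    (hS : F.IsSubgroupClosed) (f : G →* H) (hf : Function.Surjective f) :
    (F.residual G).map f = F.residual H := by
  refine le_antisymm (hF.residual_map_le hS f) ?_
  have := hF.residual_normal (G := G)
  have hn : ((F.residual G).map f).Normal := this.map f hf
  refine residual_le_of_mem_quotient ?_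
  exact hF.image (QuotientGroup.map (F.residual G) _ f (Subgroup.le_comap_map f _))
    (QuotientGroup.map_surjective_of_surjective _ _ _
      (QuotientGroup.mk_surjective.comp hf) _) (hF.mem_quotient_of_residual_le le_rfl)

end GroupClass

/-! ### Orders with prescribed prime divisors, and the radical of σ-groups -/

section PiNumber

variable {σ : Set Nat.Primes}

theorem IsPiNumber.of_dvd {m n : ℕ} (h : IsPiNumber σ n) (hmn : m ∣ n) : IsPiNumber σ m :=
  fun p hp => h p (hp.trans hmn)

theorem isPiNumber_one : IsPiNumber σ 1 := fun p hp =>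
  absurd (Nat.dvd_one.1 hp) p.2.one_lt.ne'

theorem IsPiNumber.mul {m n : ℕ} (hm : IsPiNumber σ m) (hn : IsPiNumber σ n) :
    IsPiNumber σ (m * n) :=
  fun p hp => (p.2.dvd_mul.1 hp).elim (hm p) (hn p)

theorem IsPiNumber.isPGroup {A : Type*} [Group A] [Finite A] {p : Nat.Primes}
    (h : IsPiNumber {p} (Nat.card A)) : IsPGroup p A := by
  have := Fact.mk p.2
  rw [IsPGroup.iff_card]
  refine ⟨_, Nat.eq_prime_pow_of_unique_prime_dvd Nat.card_pos.ne' ?_⟩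
  intro q hq hd
  exact congrArg Subtype.val (h ⟨q, hq⟩ hd)

theorem IsPiNumber.coprime {m n : ℕ} {p : Nat.Primes} (hm : IsPiNumber {p} m)
    (hn : IsPiNumber σ n) (hp : p ∉ σ) : m.Coprime n := by
  refine Nat.coprime_of_dvd fun q hq h1 h2 => hp ?_
  have : (⟨q, hq⟩ : Nat.Primes) = p := hm ⟨q, hq⟩ h1
  exact this ▸ hn ⟨q, hq⟩ h2

theorem isPiNumber_singleton_pow (p : Nat.Primes) (n : ℕ) : IsPiNumber {p} ((p : ℕ) ^ n) := by
  intro q hq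
  exact Subtype.ext ((Nat.prime_dvd_prime_iff_eq q.2 p.2).1 (q.2.dvd_of_dvd_pow hq))

variable {G : Type*} [Group G]

theorem IsPiNumber.card_sup [Finite G] {A B : Subgroup G} [A.Normal]
    (hA : IsPiNumber σ (Nat.card A)) (hB : IsPiNumber σ (Nat.card B)) :
    IsPiNumber σ (Nat.card (A ⊔ B : Subgroup G)) := by
  have h := Subgroup.relIndex_mul_relIndex ⊥ A (A ⊔ B) bot_le le_sup_left
  rw [Subgroup.relIndex_bot_left, Subgroup.relIndex_bot_left, Subgroup.relIndex_sup_left] at h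
  rw [← h]
  exact hA.mul (hB.of_dvd (Subgroup.relIndex_dvd_card A B))

end PiNumber

namespace GroupClass

variable {G : Type u} [Group G] {σ : Set Nat.Primes}

theorem le_radical_piGroups [Finite G] {N : Subgroup G} (hn : N.Normal)
    (h : IsPiNumber σ (Nat.card N)) : N ≤ (piGroups σ).radical G :=
  le_sSup ⟨hn, inferInstance, h⟩

theorem isPiNumber_card_radical [Finite G] :
    IsPiNumber σ (Nat.card ((piGroups.{u} σ).radical G)) := by
  set S := {N : Subgroup G | N.Normal ∧ (piGroups σ).Mem N}
  have hne : S.Nonempty := ⟨⊥, inferInstance, inferInstance, by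
    rw [Subgroup.card_bot]; exact isPiNumber_one⟩
  obtain ⟨N, hN⟩ := S.toFinite.exists_maximal hne
  have : (piGroups.{u} σ).radical G = N := by
    refine le_antisymm (sSup_le fun M hM => ?_) (le_sSup hN.1)
    have h1 := hN.1.1
    have h2 := hM.1
    have h3 : N ⊔ M ∈ S := ⟨inferInstance, inferInstance, hN.1.2.2.card_sup hM.2.2⟩
    exact le_sup_right.trans (hN.2 h3 le_sup_left)
  rw [this]
  exact hN.1.2.2

theorem radical_piGroups_map_le {H : Type u} [Group H] [Finite G] [Finite H] (f : G →* H)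
    (hf : Function.Surjective f) :
    ((piGroups σ).radical G).map f ≤ (piGroups σ).radical H :=
  le_radical_piGroups (((piGroups σ).radical_normal G).map f hf)
    (isPiNumber_card_radical.of_dvd (Subgroup.card_map_dvd _ f))

theorem radical_map_le (X : GroupClass.{u}) {G H : Type u} [Group G] [Group H] (e : G ≃* H) :
    (X.radical G).map e.toMonoidHom ≤ X.radical H := by
  rw [Subgroup.map_le_iff_le_comap]
  refine sSup_le fun N hN => ?_
  rw [← Subgroup.map_le_iff_le_comap]
  exact le_sSup ⟨hN.1.map _ e.surjective, X.iso (e.subgroupMap N) hN.2⟩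

theorem radical_characteristic (X : GroupClass.{u}) : (X.radical G).Characteristic :=
  Subgroup.characteristic_iff_map_le.2 fun e => X.radical_map_le e

end GroupClass

/-- By induction `B` lies in every term of the lower central series of `E`. -/
theorem Subgroup.eq_bot_of_le_commutator_of_isNilpotent {S : Type*} [Group S] {E B : Subgroup S}
    [hE : Group.IsNilpotent E] (hB : B ≤ E) (h : B ≤ ⁅E, B⁆) : B = ⊥ := by
  obtain ⟨n, hn⟩ := (Subgroup.isNilpotent_iff_lowerCentralSeries E).1 hE
  have key : ∀ n, B ≤ E.lowerCentralSeries n := by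
    intro n
    induction n with
    | zero => simpa using hB
    | succ n ih =>
      rw [Subgroup.lowerCentralSeries_succ]
      rw [Subgroup.commutator_comm] at h
      exact h.trans (Subgroup.commutator_mono ih le_rfl)
  exact le_bot_iff.1 (hn ▸ key n)

/-! ### Centrality of a chief factor in terms of the residual -/

namespace SemidirectProduct

variable {A Q : Type*} [Group A] [Group Q] (φ : Q →* MulAut A)

/-- The homomorphism from `A ⋊[φ] Q` to `MulAut A` given by the conjugation action of
`A ⋊[φ] Q` on its normal subgroup `A`. -/
def conjLeft : A ⋊[φ] Q →* MulAut A :=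
  lift MulAut.conj φ fun q => by
    ext a b
    simp [mul_assoc]

theorem inl_conjLeft (s : A ⋊[φ] Q) (a : A) : (inl (conjLeft φ s a) : A ⋊[φ] Q) =
    s * inl a * s⁻¹ := by
  ext <;> simp [conjLeft, lift, mul_assoc]

@[simp]
theorem conjLeft_inl (a : A) : conjLeft φ (inl a) = MulAut.conj a := by
  simp [conjLeft]

@[simp]
theorem conjLeft_inr (q : Q) : conjLeft φ (inr q) = φ q := by
  simp [conjLeft]

variable {φ}

theorem conjLeft_mem_range (hc : ∀ a, MulAut.conj a ∈ φ.range) (s : A ⋊[φ] Q) :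
    conjLeft φ s ∈ φ.range := by
  rw [← inl_left_mul_inr_right s, map_mul, conjLeft_inl, conjLeft_inr]
  exact mul_mem (hc _) ⟨_, rfl⟩

end SemidirectProduct

namespace GroupClass

open SemidirectProduct

variable {F : GroupClass.{u}} {A Q : Type u} [Group A] [Group Q] {φ : Q →* MulAut A}

/-- Let E be the residual of the semidirect product. If E is nilpotent, [E, A] is a `Q`-invariant
subgroup of the irreducible group `A`; it cannot be all of `A`, so E centralizes `A`, and `Q` is the
image of the conjugation action on `A`, whose kernel contains E. Conversely, if `Q` is in `F`, both
the projection to `Q` and the conjugation action kill E, so E lies in the centre of `A` and is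
abelian. The hypothesis `hc` keeps the image of the action equal to that of `Q` even when `A` is not
abelian. -/
theorem IsFormation.semidirectProduct_mem_iff [Finite A] [Finite Q] [Nontrivial A]
    (hF : F.IsFormation) (hS : F.IsSubgroupClosed) (hφ : Function.Injective φ)
    (hc : ∀ a, MulAut.conj a ∈ φ.range)
    (hmin : ∀ B : Subgroup A, (∀ q, ∀ b ∈ B, φ q b ∈ B) → B = ⊥ ∨ B = ⊤) :
    (formationProduct nilpotent F).Mem (A ⋊[φ] Q) ↔ F.Mem Q := by
  have hfin : Finite (A ⋊[φ] Q) := Finite.of_equiv _ SemidirectProduct.equivProd.symm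
  let f : A ⋊[φ] Q →* φ.range := (conjLeft φ).codRestrict _ (conjLeft_mem_range hc)
  have hf : Function.Surjective f := by
    rintro ⟨_, q, rfl⟩
    exact ⟨inr q, Subtype.ext (conjLeft_inr φ q)⟩
  let e : Q ≃* φ.range := MonoidHom.ofInjective hφ
  have hn := hF.residual_normal (G := A ⋊[φ] Q)
  constructor
  · rintro ⟨-, -, hnil⟩
    set E := F.residual (A ⋊[φ] Q)
    set B : Subgroup (A ⋊[φ] Q) := (rightHom : A ⋊[φ] Q →* Q).ker with hB
    have hBinl : B = (inl : A →* A ⋊[φ] Q).range := range_inl_eq_ker_rightHom.symm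
    have hle : ⁅E, B⁆ ≤ E ⊓ B := Subgroup.commutator_le_inf E B
    have hinv : ∀ q, ∀ b ∈ (⁅E, B⁆).comap inl, φ q b ∈ (⁅E, B⁆).comap inl := by
      intro q b hb
      rw [Subgroup.mem_comap] at hb ⊢
      rw [inl_aut]
      have := (inferInstance : (⁅E, B⁆).Normal).conj_mem _ hb (inr q)
      simpa using this
    refine F.iso e.symm (hF.residual_eq_bot_iff.1 ?_)
    rw [← hF.residual_map_of_surjective hS f hf, ← le_bot_iff, Subgroup.map_le_iff_le_comap]
    rcases hmin _ hinv with h | h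
    · intro s hs
      rw [Subgroup.mem_comap, Subgroup.mem_bot]
      refine Subtype.ext (MulEquiv.ext fun a => inl_injective (φ := φ) ?_)
      change inl (conjLeft φ s a) = inl a
      rw [inl_conjLeft]
      have hmem : ⁅s, (inl a : A ⋊[φ] Q)⁆ ∈ ⁅E, B⁆ :=
        Subgroup.commutator_mem_commutator hs (by rw [hBinl]; exact ⟨a, rfl⟩)
      obtain ⟨b, hb⟩ : ⁅s, (inl a : A ⋊[φ] Q)⁆ ∈ (inl : A →* A ⋊[φ] Q).range := by
        rw [← hBinl]
        exact (hle hmem).2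
      have hb1 : b ∈ (⁅E, B⁆).comap inl := by
        rw [Subgroup.mem_comap, hb]
        exact hmem
      rw [h, Subgroup.mem_bot] at hb1
      rw [hb1, map_one] at hb
      rwa [eq_comm, commutatorElement_def, mul_inv_eq_one] at hb
    · exfalso
      have h1 : B ≤ ⁅E, B⁆ := by
        intro b hb
        rw [hBinl] at hb
        obtain ⟨a, rfl⟩ := hb
        have : a ∈ (⁅E, B⁆).comap inl := h ▸ Subgroup.mem_top a
        exact this
      have h2 : B = ⊥ :=
        Subgroup.eq_bot_of_le_commutator_of_isNilpotent (hE := hnil)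
          ((h1.trans hle).trans inf_le_left) h1
      obtain ⟨a, ha⟩ := exists_ne (1 : A)
      have h3 : (inl a : A ⋊[φ] Q) ∈ B := by rw [hBinl]; exact ⟨a, rfl⟩
      rw [h2, Subgroup.mem_bot] at h3
      exact ha (inl_injective (h3.trans (map_one _).symm))
  · intro hQ
    refine ⟨hfin, inferInstance, ?_⟩
    have h1 : F.residual (A ⋊[φ] Q) ≤ (rightHom : A ⋊[φ] Q →* Q).ker := by
      rw [← MonoidHom.comap_bot, ← Subgroup.map_le_iff_le_comap]
      exact (hF.residual_map_le hS _).trans (hF.residual_eq_bot_iff.2 hQ).le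
    have h2 : F.residual (A ⋊[φ] Q) ≤ f.ker := by
      rw [← MonoidHom.comap_bot, ← Subgroup.map_le_iff_le_comap]
      exact (hF.residual_map_le hS _).trans (hF.residual_eq_bot_iff.2 (F.iso e hQ)).le
    have hcomm : ∀ x y : F.residual (A ⋊[φ] Q), x * y = y * x := by
      rintro ⟨x, hx⟩ ⟨y, hy⟩
      refine Subtype.ext ?_
      change x * y = y * x
      have hy1 := h1 hy
      rw [← range_inl_eq_ker_rightHom] at hy1
      obtain ⟨a, rfl⟩ := hy1
      have hx2 : conjLeft φ x = 1 := congrArg Subtype.val (h2 hx)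
      have := inl_conjLeft φ x a
      rw [hx2] at this
      exact (eq_mul_inv_iff_mul_eq.1 this).symm
    let _ : CommGroup (F.residual (A ⋊[φ] Q)) := { mul_comm := hcomm }
    exact CommGroup.isNilpotent

end GroupClass

section Factor

variable {G : Type u} [Group G] {K L : Subgroup G} [K.Normal] [L.Normal]

theorem mem_ker_factorAction_iff {g : G} :
    g ∈ (factorAction K L).ker ↔ ∀ l ∈ L, ⁅g, l⁆ ∈ K := by
  rw [MonoidHom.mem_ker]
  constructor
  · intro h l hl
    have h1 : (l : G ⧸ K) ∈ factorSubgroup K L := ⟨l, hl, rfl⟩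
    have h2 := congrArg Subtype.val (DFunLike.congr_fun h ⟨(l : G ⧸ K), h1⟩)
    have h3 : (g : G ⧸ K) * l * (g : G ⧸ K)⁻¹ = l := h2
    rw [← QuotientGroup.eq_one_iff, commutatorElement_def]
    change (g : G ⧸ K) * l * (g : G ⧸ K)⁻¹ * (l : G ⧸ K)⁻¹ = 1
    rw [h3, mul_inv_cancel]
  · intro h
    refine MulEquiv.ext ?_
    rintro ⟨_, l, hl, rfl⟩
    refine Subtype.ext ?_
    change (g : G ⧸ K) * l * (g : G ⧸ K)⁻¹ = l
    have : (g : G ⧸ K) * l * (g : G ⧸ K)⁻¹ * (l : G ⧸ K)⁻¹ = 1 :=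
      (QuotientGroup.eq_one_iff _).2 (h l hl)
    rwa [mul_inv_eq_one] at this

theorem card_factorSubgroup {K L : Subgroup G} [K.Normal] : Nat.card (factorSubgroup K L) = K.relIndex L := by
  have := Subgroup.relIndex_ker (K := L) (QuotientGroup.mk' K)
  rw [QuotientGroup.ker_mk'] at this
  exact this.symm

theorem GroupClass.IsFormation.isFactorCentral_iff [Finite G] {F : GroupClass.{u}}
    (hF : F.IsFormation) (hS : F.IsSubgroupClosed) (hKL : IsChiefFactor K L) :
    IsFactorCentral (formationProduct nilpotent F) K L ↔ ⁅F.residual G, L⁆ ≤ K := by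
  have hnt : Nontrivial (factorSubgroup K L) := by
    rw [Subgroup.nontrivial_iff_ne_bot]
    intro h
    rw [factorSubgroup, Subgroup.map_eq_bot_iff, QuotientGroup.ker_mk'] at h
    exact hKL.lt.not_ge h
  rw [IsFactorCentral, hF.semidirectProduct_mem_iff hS]
  · trans F.residual G ≤ (factorAction K L).ker
    · exact ⟨GroupClass.residual_le_of_mem_quotient, hF.mem_quotient_of_residual_le⟩
    · rw [Subgroup.commutator_le]
      exact ⟨fun h g hg => mem_ker_factorAction_iff.1 (h hg),
        fun h g hg => mem_ker_factorAction_iff.2 (h g hg)⟩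
  · exact QuotientGroup.kerLift_injective _
  · rintro ⟨_, l, hl, rfl⟩
    refine ⟨(l : G ⧸ (factorAction K L).ker), MulEquiv.ext fun a => Subtype.ext rfl⟩
  · intro B hB
    -- An invariant subgroup of L/K pulls back to a normal subgroup of `G` between `K` and `L`, so
    -- chiefness gives irreducibility.
    let N : Subgroup G := (B.map (factorSubgroup K L).subtype).comap (QuotientGroup.mk' K)
    have hN : N.Normal := by
      refine ⟨fun n hn g => ?_⟩
      obtain ⟨b, hb, hbn⟩ := hn
      refine ⟨_, hB (g : G ⧸ (factorAction K L).ker) b hb, ?_⟩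
      change (g : G ⧸ K) * b * (g : G ⧸ K)⁻¹ = (g * n * g⁻¹ : G)
      have : (b : G ⧸ K) = n := hbn
      rw [this]
      rfl
    have hKN : K ≤ N := by
      intro k hk
      refine ⟨1, one_mem _, ?_⟩
      exact ((QuotientGroup.eq_one_iff k).2 hk).symm
    have hNL : N ≤ L := by
      rintro n ⟨⟨_, l, hl, rfl⟩, hb, hbn⟩
      have h1 : l⁻¹ * n ∈ K := QuotientGroup.eq.1 hbn
      have := mul_mem hl (hKL.lt.le h1)
      rwa [mul_inv_cancel_left] at this
    rcases hKL.eq_or_eq N hN hKN hNL with h | h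
    · left
      rw [eq_bot_iff]
      rintro ⟨_, l, hl, rfl⟩ hb
      have : l ∈ N := ⟨_, hb, rfl⟩
      rw [h] at this
      exact Subtype.ext ((QuotientGroup.eq_one_iff l).2 this)
    · right
      rw [eq_top_iff]
      rintro ⟨_, l, hl, rfl⟩ -
      rw [← h] at hl
      obtain ⟨b, hb, hbl⟩ := hl
      have : b = ⟨QuotientGroup.mk' K l, ⟨l, hl, rfl⟩⟩ := Subtype.ext hbl
      exact this ▸ hb

end Factor

/-! ### Conjugacy of complements and Frattini arguments -/

namespace Subgroup

-- Each complement is the stabilizer of its own class in `N.QuotientDiff`, and `N` permutes these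
-- classes transitively.
open scoped Pointwise in
theorem IsComplement'.exists_conj_of_coprime {G : Type*} [Group G] [Finite G] {N : Subgroup G}
    [N.Normal] [IsMulCommutative N] (hN : (Nat.card N).Coprime N.index) {Q₁ Q₂ : Subgroup G}
    (h₁ : IsComplement' N Q₁) (h₂ : IsComplement' N Q₂) :
    ∃ n ∈ N, Q₂ = Q₁.map (MulAut.conj n).toMonoidHom := by
  have key : ∀ Q : Subgroup G, IsComplement' N Q →
      ∃ α : N.QuotientDiff, MulAction.stabilizer G α = Q := by
    intro Q hQ
    let S : N.LeftTransversal := ⟨(Q : Set G), hQ.symm⟩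
    let α : N.QuotientDiff := Quotient.mk'' S
    refine ⟨α, ?_⟩
    have hle : Q ≤ MulAction.stabilizer G α := by
      intro q hq
      rw [MulAction.mem_stabilizer_iff]
      refine congrArg Quotient.mk'' (Subtype.ext ?_)
      change MulOpposite.op q⁻¹ • (Q : Set G) = Q
      exact op_smul_coe_set (inv_mem hq)
    have hc := isComplement'_stabilizer_of_coprime (α := α) hN
    refine (Subgroup.eq_of_le_of_card_ge hle ?_).symm
    have e := hc.card_mul_card.trans hQ.card_mul_card.symm
    exact (Nat.eq_of_mul_eq_mul_left Nat.card_pos e).le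
  obtain ⟨α₁, hα₁⟩ := key Q₁ h₁
  obtain ⟨α₂, hα₂⟩ := key Q₂ h₂
  obtain ⟨n, hn⟩ := exists_smul_eq hN α₁ α₂
  refine ⟨n, n.2, ?_⟩
  have hn' : (n : G) • α₁ = α₂ := hn
  rw [← hα₂, ← hn', MulAction.stabilizer_smul_eq_stabilizer_map_conj, hα₁]

/-- The Frattini argument for complements of an abelian normal Hall subgroup. -/
theorem exists_complement_sup_normalizer_eq_top {H : Type*} [Group H] [Finite H]
    {A W : Subgroup H} [A.Normal] [W.Normal] [hA : IsMulCommutative A] (hAW : A ≤ W)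
    (hc : (Nat.card A).Coprime (A.relIndex W)) :
    ∃ Q ≤ W, A ⊓ Q = ⊥ ∧ A ⊔ Q = W ∧ A ⊔ normalizer (Q : Set H) = ⊤ := by
  have hcard : Nat.card (A.subgroupOf W) = Nat.card A :=
    Nat.card_congr (subgroupOfEquivOfLe hAW).toEquiv
  have hcop : (Nat.card (A.subgroupOf W)).Coprime (A.subgroupOf W).index := by
    rw [hcard]; exact hc
  have hcomm : IsMulCommutative (A.subgroupOf W) :=
    ⟨⟨fun x y => Subtype.ext (Subtype.ext
      (congrArg (Subtype.val : A → H) (hA.is_comm.comm ⟨x.1.1, x.2⟩ ⟨y.1.1, y.2⟩)))⟩⟩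
  obtain ⟨Q, hQ⟩ := exists_right_complement'_of_coprime hcop
  refine ⟨Q.map W.subtype, map_subtype_le Q, ?_, ?_, ?_⟩
  · have := hQ.disjoint.eq_bot
    rw [← map_subgroupOf_eq_of_le hAW, ← map_inf _ _ _ W.subtype_injective, this, map_bot]
  · have := hQ.sup_eq_top
    conv_lhs => rw [← map_subgroupOf_eq_of_le hAW, ← map_sup, this]
    rw [← MonoidHom.range_eq_map, range_subtype]
  · rw [eq_top_iff]
    intro h _
    let e : W ≃* W := MulAut.conjNormal h
    have hQ2 : IsComplement' (A.subgroupOf W)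
        (Q.map e.toMonoidHom) := by
      refine isComplement'_of_coprime ?_ ?_
      · rw [card_map_of_injective (f := e.toMonoidHom) e.injective]
        exact hQ.card_mul_card
      · rw [card_map_of_injective (f := e.toMonoidHom) e.injective]
        rwa [← hQ.symm.index_eq_card]
    obtain ⟨n, hn, hQn⟩ := IsComplement'.exists_conj_of_coprime hcop hQ hQ2
    have hmem : (n : H)⁻¹ * h ∈ normalizer ((Q.map W.subtype : Subgroup H) : Set H) := by
      refine mem_normalizer_fintype ?_
      rintro _ ⟨q, hq, rfl⟩
      have h1 : MulAut.conjNormal h q ∈ Q.map (MulAut.conj n).toMonoidHom := by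
        rw [← hQn]
        exact ⟨q, hq, rfl⟩
      obtain ⟨r, hr, hrq⟩ := h1
      refine ⟨r, hr, ?_⟩
      have h2 : (n : H) * r * (n : H)⁻¹ = h * q * h⁻¹ := congrArg Subtype.val hrq
      change (r : H) = (n : H)⁻¹ * h * q * ((n : H)⁻¹ * h)⁻¹
      rw [mul_inv_rev, inv_inv]
      calc (r : H) = (n : H)⁻¹ * (n * r * (n : H)⁻¹) * n := by group
        _ = _ := by rw [h2]; group
    rw [← mul_inv_cancel_left (n : H) h]
    exact mul_mem_sup hn hmem

theorem sup_comap_eq_comap_map_sup {G H : Type*} [Group G] [Group H] {f : G →* H}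
    (hf : Function.Surjective f) (K : Subgroup G) (X : Subgroup H) :
    K ⊔ X.comap f = (K.map f ⊔ X).comap f := by
  have hk : f.ker ≤ K ⊔ X.comap f := (MonoidHom.ker_le_comap f X).trans le_sup_right
  rw [← sup_eq_left.2 hk, ← comap_map_eq, map_sup, map_comap_eq_self_of_surjective hf]

/-- If a normal `p`-subgroup `P` with index in `T` prime to `p` has no proper supplement,
then it has a normal complement in `T`. -/
theorem exists_normal_complement_of_isPGroup {H : Type*} [Group H] [Finite H] {p : ℕ}
    [Fact p.Prime] {P T : Subgroup H} [P.Normal] [T.Normal] (hPT : P ≤ T) (hP : IsPGroup p P)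
    (hc : p.Coprime (P.relIndex T)) (hfr : ∀ X : Subgroup H, P ⊔ X = ⊤ → X = ⊤) :
    ∃ V : Subgroup H, V.Normal ∧ P ⊓ V = ⊥ ∧ P ⊔ V = T := by
  obtain ⟨V, ⟨hVn, hV⟩, hmin⟩ :=
    (Set.toFinite {V : Subgroup H | V.Normal ∧ P ⊔ V = T}).exists_minimal
      ⟨T, inferInstance, sup_eq_right.2 hPT⟩
  refine ⟨V, hVn, ?_, hV⟩
  set P₁ := P ⊓ V with hP₁
  have hP₁p : IsPGroup p P₁ := hP.to_le inf_le_left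
  have hnil : Group.IsNilpotent P₁ := hP₁p.isNilpotent
  -- It remains to see that `P₁` is perfect. Modulo its derived subgroup it is an abelian normal
  -- Hall subgroup of the image of `V`, with a complement `Q`. The normalizer of `Q` supplements the
  -- image of `P`, so `Q` is normal; minimality of `V` then puts `V` inside the preimage of `Q`.
  refine eq_bot_of_le_commutator_of_isNilpotent le_rfl ?_
  set N := ⁅P₁, P₁⁆ with hN
  have hNP : N ≤ P₁ := (commutator_le_inf P₁ P₁).trans inf_le_left
  have hNV : N ≤ V := hNP.trans inf_le_right
  let f := QuotientGroup.mk' N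
  have hf : Function.Surjective f := QuotientGroup.mk'_surjective N
  have hker : f.ker = N := QuotientGroup.ker_mk' N
  have hAn : (P₁.map f).Normal := Normal.map inferInstance f hf
  have hWn : (V.map f).Normal := Normal.map inferInstance f hf
  have hcomm : IsMulCommutative (P₁.map f) := by
    rw [← le_centralizer_iff_isMulCommutative, ← commutator_eq_bot_iff_le_centralizer,
      ← map_commutator, map_eq_bot_iff, hker]
  have hrel : P₁.relIndex V = P.relIndex T := by
    rw [hP₁, inf_relIndex_right, ← relIndex_sup_left V P, hV]
  have hcop : (Nat.card (P₁.map f)).Coprime ((P₁.map f).relIndex (V.map f)) := by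
    rw [relIndex_map_map, hker, sup_eq_left.2 hNP, sup_eq_left.2 hNV, hrel]
    obtain ⟨n, hn⟩ := IsPGroup.iff_card.1 (hP₁p.map f)
    rw [hn]
    exact hc.pow_left n
  obtain ⟨Q, hQW, hdisj, hsup, htop⟩ :=
    exists_complement_sup_normalizer_eq_top (map_mono inf_le_right) hcop
  have hQn : Q.Normal := by
    rw [← normalizer_eq_top_iff]
    have h1 := sup_comap_eq_comap_map_sup hf P₁ (normalizer (Q : Set (H ⧸ N)))
    rw [htop, comap_top] at h1
    have h2 := hfr ((normalizer (Q : Set (H ⧸ N))).comap f)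
      (top_le_iff.1 (h1.ge.trans (sup_le_sup_right inf_le_left _)))
    rw [← map_comap_eq_self_of_surjective hf (normalizer (Q : Set (H ⧸ N))), h2,
      map_top_of_surjective f hf]
  have hV₂ : P₁ ⊔ Q.comap f = V := by
    rw [sup_comap_eq_comap_map_sup hf, hsup, comap_map_eq, hker, sup_eq_left.2 hNV]
  have hle : V ≤ Q.comap f := by
    refine hmin ⟨hQn.comap f, ?_⟩ (le_sup_right.trans hV₂.le)
    calc P ⊔ Q.comap f = P ⊔ P₁ ⊔ Q.comap f := by rw [sup_eq_left.2 (inf_le_left : P₁ ≤ P)]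
      _ = T := by rw [sup_assoc, hV₂, hV]
  rw [← hker, ← map_eq_bot_iff, ← hdisj, left_eq_inf, map_le_iff_le_comap]
  exact inf_le_right.trans hle

end Subgroup

/-! ### Chief factors, π-solvability and actions of p-groups -/

section ChiefFactor

variable {G H : Type u} [Group G] [Group H]

theorem IsChiefFactor.comap_of_surjective {f : G →* H} (hf : Function.Surjective f)
    {K L : Subgroup H} (h : IsChiefFactor K L) : IsChiefFactor (K.comap f) (L.comap f) := by
  have h1 := h.bot_normal
  have h2 := h.top_normal
  refine ⟨inferInstance, inferInstance, (Subgroup.comap_lt_comap_of_surjective hf).2 h.lt, ?_⟩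
  intro N hN hKN hNL
  have hc : (N.map f).comap f = N :=
    Subgroup.comap_map_eq_self ((MonoidHom.ker_le_comap f K).trans hKN)
  rw [← hc] at hKN hNL
  rw [Subgroup.comap_le_comap_of_surjective hf] at hKN hNL
  rcases h.eq_or_eq _ (hN.map _ hf) hKN hNL with h' | h'
  · left; rw [← h', hc]
  · right; rw [← h', hc]

/-- A homomorphism whose kernel meets `L` in `K` maps the chief factor `L / K` to a minimal
normal subgroup. -/
theorem IsChiefFactor.map_of_ker_inf_eq {f : G →* H} (hf : Function.Surjective f)
    {K L : Subgroup G} (h : IsChiefFactor K L) (hK : f.ker ⊓ L = K) :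
    IsChiefFactor ⊥ (L.map f) := by
  have h2 := h.top_normal
  refine ⟨inferInstance, h2.map f hf, ?_, ?_⟩
  · rw [bot_lt_iff_ne_bot, Ne, Subgroup.map_eq_bot_iff]
    intro hle
    exact h.lt.ne (by rw [← hK, inf_eq_right.2 hle])
  · intro X hX _ hXL
    have hn : (X.comap f).Normal := hX.comap f
    have hKX : K ≤ X.comap f ⊓ L := by
      rw [← hK]
      exact inf_le_inf_right _ (MonoidHom.ker_le_comap f X)
    rcases h.eq_or_eq (X.comap f ⊓ L) inferInstance hKX inf_le_right with h' | h'
    · left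
      rw [eq_bot_iff]
      intro x hx
      obtain ⟨l, hl, rfl⟩ := hXL hx
      have : l ∈ X.comap f ⊓ L := ⟨hx, hl⟩
      rw [h', ← hK] at this
      exact this.1
    · right
      refine le_antisymm hXL ?_
      rw [Subgroup.map_le_iff_le_comap, ← inf_eq_right]
      exact h'

theorem Subgroup.Normal.exists_isChiefFactor_bot [Finite G] {N : Subgroup G} (hN : N.Normal)
    (hne : N ≠ ⊥) : ∃ R ≤ N, IsChiefFactor ⊥ R := by
  obtain ⟨R, ⟨h1, h2, h3⟩, hmin⟩ :=
    (Set.toFinite {R : Subgroup G | R.Normal ∧ R ≤ N ∧ R ≠ ⊥}).exists_minimal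
      ⟨N, hN, le_rfl, hne⟩
  refine ⟨R, h2, inferInstance, h1, bot_lt_iff_ne_bot.2 h3, fun X hX _ hXR => ?_⟩
  by_cases hb : X = ⊥
  · exact Or.inl hb
  · exact Or.inr (le_antisymm hXR (hmin ⟨hX, hXR.trans h2, hb⟩ hXR))

theorem GroupClass.piSolvable_mem_of_surjective {π : Set Nat.Primes} [Finite H] {f : G →* H}
    (hf : Function.Surjective f) (hG : (piSolvable π).Mem G) : (piSolvable π).Mem H := by
  refine ⟨inferInstance, fun K L hKL => ?_⟩
  have := hG.2 _ _ (hKL.comap_of_surjective hf)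
  rwa [Subgroup.relIndex_comap, Subgroup.map_comap_eq_self_of_surjective hf] at this

theorem GroupClass.piSolvable_mem_map {π : Set Nat.Primes} [Finite H] (f : G →* H)
    {D : Subgroup G} (hD : (piSolvable π).Mem D) : (piSolvable π).Mem (D.map f) :=
  piSolvable_mem_of_surjective (f.subgroupMap_surjective D) hD

variable [Finite G]

/-- A minimal normal subgroup of `G` inside a `π`-solvable normal subgroup is a `π'`-group or a
`p`-group with `p ∈ π`. -/
theorem IsChiefFactor.isPiNumber_card_of_le_piSolvable {π : Set Nat.Primes} {D R : Subgroup G}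
    [D.Normal] (hD : (GroupClass.piSolvable π).Mem D) (hR : IsChiefFactor ⊥ R) (hRD : R ≤ D) :
    IsPiNumber πᶜ (Nat.card R) ∨ ∃ p ∈ π, IsPiNumber {p} (Nat.card R) := by
  have hRn := hR.top_normal
  have hne : R.subgroupOf D ≠ ⊥ := by
    rw [Ne, Subgroup.subgroupOf_eq_bot, disjoint_iff, inf_eq_left.2 hRD]
    exact hR.lt.ne'
  obtain ⟨S, hSR, hS⟩ :=
    Subgroup.Normal.exists_isChiefFactor_bot (inferInstance : (R.subgroupOf D).Normal) hne
  -- The σ-radical of `D` is characteristic in `D`, hence normal in `G`. It contains `S`, so it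
  -- meets `R` nontrivially and therefore contains `R`.
  have key : ∀ σ : Set Nat.Primes, IsPiNumber σ (Nat.card S) → IsPiNumber σ (Nat.card R) := by
    intro σ hσ
    set X := (GroupClass.piGroups.{u} σ).radical D
    have hXc : X.Characteristic := GroupClass.radical_characteristic _
    have hXn : (X.map D.subtype).Normal := inferInstance
    have hX : IsPiNumber σ (Nat.card (X.map D.subtype)) :=
      GroupClass.isPiNumber_card_radical.of_dvd (Subgroup.card_map_dvd _ _)
    have hSX : S ≤ X := GroupClass.le_radical_piGroups hS.top_normal hσ
    rcases hR.eq_or_eq (R ⊓ X.map D.subtype) inferInstance bot_le inf_le_left with h | h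
    · exfalso
      refine hS.lt.ne' (le_bot_iff.1 fun s hs => ?_)
      have : (s : G) ∈ R ⊓ X.map D.subtype := ⟨hSR hs, s, hSX hs, rfl⟩
      rw [h] at this
      exact Subtype.ext this
    · exact hX.of_dvd (Subgroup.card_dvd_of_le (inf_eq_left.1 h))
  rcases hD.2 _ _ hS with h | ⟨p, hp, n, h⟩
  · rw [Subgroup.relIndex_bot_left] at h
    exact Or.inl (key _ h)
  · rw [Subgroup.relIndex_bot_left] at h
    exact Or.inr ⟨p, hp, key _ (h ▸ isPiNumber_singleton_pow p n)⟩

/-- A normal subgroup that induces a `p`-group of automorphisms on a minimal normal `p`-subgroup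
centralizes it. -/
theorem IsChiefFactor.le_centralizer_of_isPGroup {p : ℕ} [Fact p.Prime] {R T : Subgroup G}
    [R.Normal] [T.Normal] (hR : IsChiefFactor ⊥ R) (hRp : IsPGroup p R)
    (hT : IsPGroup p (T.map (MulAut.conjNormal : G →* MulAut R))) :
    T ≤ Subgroup.centralizer (R : Set G) := by
  have hnt : Nontrivial R := (Subgroup.nontrivial_iff_ne_bot R).2 hR.lt.ne'
  have hdvd : p ∣ Nat.card R := hRp.card_eq_or_dvd.resolve_left Finite.one_lt_card.ne'
  have h1 : (1 : R) ∈ MulAction.fixedPoints (T.map (MulAut.conjNormal : G →* MulAut R)) R :=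
    fun g => map_one (g : MulAut R)
  -- The number of fixed points is divisible by `p`, so there is one besides 1.
  obtain ⟨b, hb, hb1⟩ := hT.exists_fixed_point_of_prime_dvd_card_of_fixed_point R hdvd h1
  have hbT : (b : G) ∈ R ⊓ Subgroup.centralizer (T : Set G) := by
    refine ⟨b.2, Subgroup.mem_centralizer_iff.2 fun t ht => ?_⟩
    have h2 := congrArg Subtype.val (hb ⟨MulAut.conjNormal t, t, ht, rfl⟩)
    have h3 : t * b * t⁻¹ = (b : G) := h2
    exact mul_inv_eq_iff_eq_mul.1 h3
  rcases hR.eq_or_eq (R ⊓ Subgroup.centralizer (T : Set G)) inferInstance bot_le inf_le_left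
    with h | h
  · rw [h] at hbT
    exact absurd (Subtype.ext (Subgroup.mem_bot.1 hbT)).symm hb1
  · exact Subgroup.le_centralizer_iff.1 (inf_eq_left.1 h)

end ChiefFactor

/-- If `T / C` is a normal `p'`-section of `G`, some supplement `H` of `C` in `G` normalizes a
`p'`-subgroup `V` with `T = V C`. -/
theorem Subgroup.exists_supplement_normalizing {G : Type*} [Group G] [Finite G] {p : ℕ}
    [Fact p.Prime] {C T : Subgroup G} [C.Normal] [T.Normal] (hCT : C ≤ T)
    (hc : p.Coprime (C.relIndex T)) :
    ∃ H V : Subgroup G, H ⊔ C = ⊤ ∧ H ≤ normalizer (V : Set G) ∧ V ⊔ C = T ∧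
      p.Coprime (Nat.card V) := by
  -- A minimal supplement makes C ∩ H have no proper supplement in `H`; a Sylow `p`-subgroup of C ∩
  -- H is then normal in `H` by Frattini, and has a normal complement in T ∩ H.
  obtain ⟨H, hH, hmin⟩ :=
    (Set.toFinite {H : Subgroup G | H ⊔ C = ⊤}).exists_minimal ⟨⊤, top_sup_eq C⟩
  have hfr : ∀ X : Subgroup H, X ⊔ C.subgroupOf H = ⊤ → X = ⊤ := by
    intro X hX
    have h1 : X.map H.subtype ⊔ C = ⊤ := by
      rw [eq_top_iff, ← hH]
      refine sup_le ?_ le_sup_right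
      have h2 := congrArg (Subgroup.map H.subtype) hX
      rw [map_sup, subgroupOf_map_subtype, ← MonoidHom.range_eq_map, range_subtype] at h2
      exact h2.ge.trans (sup_le_sup_left inf_le_left _)
    have h3 := hmin h1 (map_subtype_le X)
    rw [eq_top_iff]
    intro x _
    obtain ⟨y, hy, hyx⟩ := h3 x.2
    have : y = x := Subtype.ext hyx
    exact this ▸ hy
  have hTH : T ⊓ H ⊔ C = T := by
    refine le_antisymm (sup_le inf_le_left hCT) fun t ht => ?_
    have h1 : t ∈ H ⊔ C := hH ▸ mem_top t
    obtain ⟨h, hh, c, hcC, rfl⟩ := mem_sup_of_normal_right.1 h1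
    refine mul_mem_sup ⟨?_, hh⟩ hcC
    have := mul_mem ht (inv_mem (hCT hcC))
    rwa [mul_inv_cancel_right] at this
  let S : Sylow p (C.subgroupOf H) := default
  set P : Subgroup H := (S : Subgroup (C.subgroupOf H)).map (C.subgroupOf H).subtype with hP
  have hPC : P ≤ C.subgroupOf H := map_subtype_le _
  have hPn : P.Normal := normalizer_eq_top_iff.1 (hfr _ S.normalizer_sup_eq_top)
  have hPp : IsPGroup p P := S.isPGroup'.map _
  have hCT₀ : C.subgroupOf H ≤ T.subgroupOf H := comap_mono hCT
  have hrel : p.Coprime (P.relIndex (T.subgroupOf H)) := by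
    rw [← relIndex_mul_relIndex _ _ _ hPC hCT₀]
    refine Nat.Coprime.mul_right ?_ ?_
    · have h1 : P.subgroupOf (C.subgroupOf H) = S :=
        comap_map_eq_self_of_injective (subtype_injective _) _
      rw [relIndex, h1]
      exact (Nat.Prime.coprime_iff_not_dvd Fact.out).2 S.not_dvd_index
    · rw [subgroupOf, relIndex_comap, subgroupOf_map_subtype, ← relIndex_sup_right, hTH]
      exact hc
  obtain ⟨V, hVn, hdisj, hsup⟩ := exists_normal_complement_of_isPGroup (hPC.trans hCT₀) hPp hrel
    fun X hX => hfr X (top_le_iff.1 (hX.ge.trans (by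
      rw [sup_comm]; exact sup_le_sup_left hPC X)))
  refine ⟨H, V.map H.subtype, hH, ?_, ?_, ?_⟩
  · have := le_normalizer_map (H := V) H.subtype
    rwa [normalizer_eq_top_iff.2 hVn, ← MonoidHom.range_eq_map, range_subtype] at this
  · have h1 := congrArg (Subgroup.map H.subtype) hsup
    rw [map_sup, subgroupOf_map_subtype] at h1
    have h2 : P.map H.subtype ≤ C := map_le_iff_le_comap.2 hPC
    calc V.map H.subtype ⊔ C = P.map H.subtype ⊔ V.map H.subtype ⊔ C := by
          rw [sup_comm (P.map H.subtype), sup_assoc, sup_eq_right.2 h2]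
      _ = T := by rw [h1, hTH]
  · rw [card_map_of_injective H.subtype_injective, ← relIndex_bot_left, ← hdisj,
      inf_relIndex_right, ← relIndex_sup_left, hsup]
    exact hrel

/-! ### Minimal normal subgroups inside the norm -/

section Norm

variable {G H : Type u} [Group G] [Group H] {F : GroupClass.{u}}
  {π : Set Nat.Primes}

theorem mem_normalizer_of_mem_classNorm {X : GroupClass.{u}} {x : G} (hx : x ∈ classNorm X F G)
    (K : Subgroup G) : x ∈ Subgroup.normalizer
      (((F.residual K).map K.subtype ⊔ X.radical G : Subgroup G) : Set G) :=
  (Subgroup.mem_iInf.1 hx) K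

theorem commutator_mem_of_mem_normalizer {N : Subgroup G} {x n : G}
    (hx : x ∈ Subgroup.normalizer (N : Set G)) (hn : n ∈ N) : ⁅x, n⁆ ∈ N :=
  mul_mem ((Subgroup.mem_normalizer_iff.1 hx n).1 hn) (inv_mem hn)

theorem Subgroup.normalizer_le_normalizer_sup (A N : Subgroup G) [hN : N.Normal] :
    normalizer (A : Set G) ≤ normalizer ((A ⊔ N : Subgroup G) : Set G) := by
  intro k hk
  have h1 : k ∈ normalizer (N : Set G) := by
    rw [normalizer_eq_top_iff.2 hN]
    exact mem_top k
  rw [mem_normalizer_iff_map_conj_eq] at h1 hk ⊢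
  rw [map_sup, h1, hk]

variable [Finite G]

/-- If `K` supplements a normal subgroup `C`, the residual of `G` is covered by `C` and the
residual of `H`. -/
theorem GroupClass.IsFormation.residual_le_sup (hF : F.IsFormation) (hS : F.IsSubgroupClosed)
    {K C : Subgroup G} [C.Normal] (hK : K ⊔ C = ⊤) :
    F.residual G ≤ (F.residual K).map K.subtype ⊔ C := by
  have hsurj : Function.Surjective ((QuotientGroup.mk' C).comp K.subtype) := by
    rw [← MonoidHom.range_eq_top, MonoidHom.range_comp, Subgroup.range_subtype]
    have := congrArg (Subgroup.map (QuotientGroup.mk' C)) hK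
    rwa [Subgroup.map_sup, QuotientGroup.map_mk'_self, sup_bot_eq,
      Subgroup.map_top_of_surjective _ (QuotientGroup.mk'_surjective C)] at this
  have h1 := hF.residual_map_of_surjective hS _ hsurj
  have h2 := hF.residual_map_le hS (QuotientGroup.mk' C)
  rw [← h1, ← Subgroup.map_map, Subgroup.map_le_iff_le_comap, Subgroup.comap_map_eq,
    QuotientGroup.ker_mk'] at h2
  exact h2

theorem IsChiefFactor.commutator_residual_eq_bot (hF : F.IsFormation) (hS : F.IsSubgroupClosed)
    (hD : (GroupClass.piSolvable π).Mem (F.residual G)) {R : Subgroup G}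
    (hR : IsChiefFactor ⊥ R) (hRN : R ≤ classNorm (GroupClass.piGroups πᶜ) F G)
    {p : Nat.Primes} (hp : p ∈ π) (hpR : (p : ℕ) ∣ Nat.card R) : ⁅F.residual G, R⁆ = ⊥ := by
  have hpf := Fact.mk p.2
  have hRn := hR.top_normal
  have hDn := hF.residual_normal (G := G)
  set D := F.residual G with hDdef
  rcases hR.eq_or_eq ⁅D, R⁆ inferInstance bot_le
    ((Subgroup.commutator_le_inf D R).trans inf_le_right) with h | hDR
  · exact h
  have hRD : R ≤ D := hDR.ge.trans ((Subgroup.commutator_le_inf D R).trans inf_le_left)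
  have hRp : IsPiNumber {p} (Nat.card R) := by
    rcases hR.isPiNumber_card_of_le_piSolvable hD hRD with h | ⟨q, -, h⟩
    · exact absurd hp (h p hpR)
    · have : p = q := h p hpR
      rwa [this]
  set C := D ⊓ Subgroup.centralizer (R : Set G) with hC
  have hCR : C ≤ Subgroup.centralizer (R : Set G) := inf_le_right
  rw [Subgroup.commutator_eq_bot_iff_le_centralizer]
  by_contra hDC
  let f := QuotientGroup.mk' C
  have hf : Function.Surjective f := QuotientGroup.mk'_surjective C
  have hker : f.ker = C := QuotientGroup.ker_mk' C
  have hDfn : (D.map f).Normal := hDn.map f hf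
  have hDf : D.map f ≠ ⊥ := by
    rw [Ne, Subgroup.map_eq_bot_iff, hker]
    exact fun h => hDC (h.trans hCR)
  obtain ⟨T', hT'D, hT'⟩ := hDfn.exists_isChiefFactor_bot hDf
  have hT'n := hT'.top_normal
  set T := T'.comap f with hT
  have hmapT : T.map f = T' := Subgroup.map_comap_eq_self_of_surjective hf T'
  have hCT : C ≤ T := hker ▸ MonoidHom.ker_le_comap f T'
  have hTD : T ≤ D := by
    have h := Subgroup.comap_mono (f := f) hT'D
    rwa [Subgroup.comap_map_eq, hker, sup_eq_left.2 (inf_le_left : C ≤ D)] at h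
  have hTR : ¬ T ≤ Subgroup.centralizer (R : Set G) := by
    intro h
    refine hT'.lt.ne' ?_
    rw [← hmapT, Subgroup.map_eq_bot_iff, hker]
    exact le_inf hTD h
  have hT'p : (p : ℕ).Coprime (Nat.card T') := by
    rcases hT'.isPiNumber_card_of_le_piSolvable (GroupClass.piSolvable_mem_map f hD) hT'D
      with h | ⟨q, -, h⟩
    · exact (pow_one (p : ℕ) ▸ isPiNumber_singleton_pow p 1).coprime h (fun hn => hn hp)
    · have hpq : p ≠ q := by
        -- If T/C were a `p`-group, `T` would induce a `p`-group on `R`, hence centralize it.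
        rintro rfl
        refine hTR (hR.le_centralizer_of_isPGroup hRp.isPGroup ?_)
        have hCk : C ≤ (MulAut.conjNormal : G →* MulAut R).ker := by
          intro c hc
          refine MulEquiv.ext fun r => Subtype.ext ?_
          exact mul_inv_eq_iff_eq_mul.2 (Subgroup.mem_centralizer_iff.1 (hCR hc) r r.2).symm
        have h1 := h.isPGroup.map (QuotientGroup.lift C _ hCk)
        rw [← hmapT, Subgroup.map_map] at h1
        exact h1
      exact (pow_one (p : ℕ) ▸ isPiNumber_singleton_pow p 1).coprime h hpq
  have hrel : (p : ℕ).Coprime (C.relIndex T) := by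
    rwa [← hker, Subgroup.relIndex_ker, hmapT]
  obtain ⟨K, V, hKC, hKV, hVC, hVp⟩ := Subgroup.exists_supplement_normalizing hCT hrel
  set O := (GroupClass.piGroups.{u} πᶜ).radical G with hO
  have hOn : O.Normal := GroupClass.radical_normal _ _
  have hOV : IsPiNumber {p}ᶜ (Nat.card (O ⊔ V : Subgroup G)) := by
    refine IsPiNumber.card_sup ?_ ?_
    · refine fun q hq hqp => ?_
      rw [Set.mem_singleton_iff.1 hqp] at hq
      exact GroupClass.isPiNumber_card_radical p hq hp
    · intro q hq hqp
      rw [Set.mem_singleton_iff.1 hqp] at hq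
      exact (Nat.Prime.coprime_iff_not_dvd p.2).1 hVp hq
  have hOVR : (O ⊔ V) ⊓ R = ⊥ :=
    (Subgroup.disjoint_of_coprime_natCard
      (hRp.coprime hOV (fun h => h rfl)).symm).eq_bot
  have hKOV : K ⊔ O ≤ Subgroup.normalizer ((O ⊔ V : Subgroup G) : Set G) := by
    refine sup_le (hKV.trans ?_) (le_sup_left.trans Subgroup.le_normalizer)
    rw [sup_comm]
    exact Subgroup.normalizer_le_normalizer_sup V O
  have hRT : R ⊓ Subgroup.centralizer (T : Set G) = ⊥ := by
    rcases hR.eq_or_eq (R ⊓ Subgroup.centralizer (T : Set G)) inferInstance bot_le inf_le_left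
      with h | h
    · exact h
    · exact absurd (Subgroup.le_centralizer_iff.1 (inf_eq_left.1 h)) hTR
  -- An element x here normalizes the p'-group OV and lies in the normal p-group `R`, so [x, V] lies
  -- in OV ∩ R = 1.
  have hKR : (K ⊔ O) ⊓ R = ⊥ := by
    rw [eq_bot_iff, ← hRT]
    rintro x ⟨hxK, hxR⟩
    refine ⟨hxR, ?_⟩
    have hle : T ≤ Subgroup.centralizer {x} := by
      rw [← hVC]
      refine sup_le (fun v hv => ?_) (hCR.trans (Subgroup.centralizer_le ?_))
      · have h1 : ⁅x, v⁆ ∈ (O ⊔ V) ⊓ R :=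
          ⟨commutator_mem_of_mem_normalizer (hKOV hxK) (Subgroup.mem_sup_right hv),
            Subgroup.commutator_le_left R ⊤
              (Subgroup.commutator_mem_commutator hxR (Subgroup.mem_top v))⟩
        rw [hOVR, Subgroup.mem_bot, commutatorElement_eq_one_iff_mul_comm] at h1
        exact Subgroup.mem_centralizer_singleton_iff.2 h1.symm
      · exact Set.singleton_subset_iff.2 hxR
    exact Subgroup.mem_centralizer_iff.2 fun t ht =>
      Subgroup.mem_centralizer_singleton_iff.1 (hle ht)
  have hres : (F.residual K).map K.subtype ≤ Subgroup.centralizer (R : Set G) := by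
    intro k hk
    refine Subgroup.mem_centralizer_iff.2 fun r hr => ?_
    have h1 : ⁅r, k⁆ ∈ (K ⊔ O) ⊓ R := by
      refine ⟨?_, Subgroup.commutator_le_left R ⊤
              (Subgroup.commutator_mem_commutator hr (Subgroup.mem_top k))⟩
      exact sup_le_sup_right (Subgroup.map_subtype_le _) O
        (commutator_mem_of_mem_normalizer (mem_normalizer_of_mem_classNorm (hRN hr) K)
          (Subgroup.mem_sup_left hk))
    rw [hKR, Subgroup.mem_bot, commutatorElement_eq_one_iff_mul_comm] at h1
    exact h1
  exact hDC ((hF.residual_le_sup hS hKC).trans (sup_le hres hCR))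

end Norm

/-! ### The norm series and the hypercentre -/

section Series

variable {G H : Type u} [Group G] [Group H] {F : GroupClass.{u}} {π : Set Nat.Primes}

theorem radical_le_classNorm {X : GroupClass.{u}} : X.radical G ≤ classNorm X F G :=
  le_iInf fun _ => le_sup_right.trans Subgroup.le_normalizer

/-- `N` centralizes the residual of `G`, which contains the residual of every subgroup. -/
theorem GroupClass.IsFormation.le_classNorm [Finite G] (hF : F.IsFormation)
    (hS : F.IsSubgroupClosed) {X : GroupClass.{u}} {N : Subgroup G}
    (hN : ⁅F.residual G, N⁆ = ⊥) : N ≤ classNorm X F G := by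
  have hX := X.radical_normal G
  rw [Subgroup.commutator_eq_bot_iff_le_centralizer, Subgroup.le_centralizer_iff] at hN
  refine le_iInf fun K => hN.trans (le_trans ?_ (Subgroup.normalizer_le_normalizer_sup _ _))
  exact (Subgroup.centralizer_le (hF.residual_map_le hS K.subtype)).trans
    (Subgroup.centralizer_le_normalizer _)

/-- Each subgroup of `H` is the image of its preimage, with residual mapping onto residual; the
radical may grow, but enlarging by a normal subgroup only enlarges the normalizer. -/
theorem GroupClass.IsFormation.classNorm_map_le [Finite G] [Finite H] (hF : F.IsFormation)
    (hS : F.IsSubgroupClosed) {f : G →* H} (hf : Function.Surjective f) :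
    (classNorm (piGroups π) F G).map f ≤ classNorm (piGroups π) F H := by
  have hn := (piGroups π).radical_normal H
  refine le_iInf fun K => ?_
  have hfK : Function.Surjective (f.subgroupComap K) :=
    f.subgroupComap_surjective_of_surjective K hf
  have h1 := hF.residual_map_of_surjective hS _ hfK
  set A := (F.residual (K.comap f)).map (K.comap f).subtype ⊔ (piGroups π).radical G with hA
  have h2 : A.map f ⊔ (piGroups π).radical H =
      (F.residual K).map K.subtype ⊔ (piGroups π).radical H := by
    rw [hA, Subgroup.map_sup, sup_assoc, sup_eq_right.2 (radical_piGroups_map_le f hf), ← h1,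
      Subgroup.map_map, Subgroup.map_map]
    rfl
  rw [← h2]
  refine le_trans ?_ (Subgroup.normalizer_le_normalizer_sup _ _)
  exact (Subgroup.map_mono (iInf_le _ (K.comap f))).trans (Subgroup.le_normalizer_map f)

instance classNormSeries_normal (X F : GroupClass.{u}) (i : ℕ) :
    (classNormSeries X F G i).Normal :=
  (classNormSeriesAux X F G i).2

theorem classNormSeries_zero (X F : GroupClass.{u}) : classNormSeries X F G 0 = ⊥ :=
  rfl

theorem classNormSeries_succ (X F : GroupClass.{u}) (i : ℕ) :
    classNormSeries X F G (i + 1) = (classNorm X F (G ⧸ classNormSeries X F G i)).comap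
      (QuotientGroup.mk' (classNormSeries X F G i)) :=
  rfl

theorem classNormSeries_monotone (X F : GroupClass.{u}) : Monotone (classNormSeries X F G) := by
  refine monotone_nat_of_le_succ fun i => ?_
  rw [classNormSeries_succ]
  exact QuotientGroup.le_comap_mk' _ _

variable [Finite G]

theorem exists_classNormInfty_eq (X F : GroupClass.{u}) :
    ∃ n, classNormInfty X F G = classNormSeries X F G n ∧
      classNormSeries X F G (n + 1) = classNormSeries X F G n := by
  obtain ⟨n, hn⟩ := WellFoundedGT.monotone_chain_condition
    ⟨classNormSeries X F G, classNormSeries_monotone X F⟩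
  refine ⟨n, le_antisymm (iSup_le fun i => ?_) (le_iSup _ n), (hn _ n.le_succ).symm⟩
  rcases le_total i n with h | h
  · exact classNormSeries_monotone X F h
  · exact (hn i h).ge

/-- Assuming only that `L` lies in `K` times the term lets the induction keep the same chief factor.
At the first index where this happens, dividing by `K` times the preceding term carries L/K
isomorphically onto a minimal normal subgroup inside the norm. -/
theorem commutator_residual_le_of_le_classNormSeries (hF : F.IsFormation)
    (hS : F.IsSubgroupClosed) (hD : (GroupClass.piSolvable π).Mem (F.residual G))
    {K L : Subgroup G} (hKL : IsChiefFactor K L) {p : Nat.Primes} (hp : p ∈ π)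
    (hpKL : (p : ℕ) ∣ K.relIndex L) (i : ℕ)
    (hL : L ≤ K ⊔ classNormSeries (GroupClass.piGroups πᶜ) F G i) : ⁅F.residual G, L⁆ ≤ K := by
  have hKn := hKL.bot_normal
  have hLn := hKL.top_normal
  induction i with
  | zero =>
    rw [classNormSeries_zero, sup_bot_eq] at hL
    exact absurd hL hKL.lt.not_ge
  | succ i ih =>
    by_cases hLi : L ≤ K ⊔ classNormSeries (GroupClass.piGroups πᶜ) F G i
    · exact ih hLi
    set M := classNormSeries (GroupClass.piGroups πᶜ) F G i with hM
    let g := QuotientGroup.mk' M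
    have hg : Function.Surjective g := QuotientGroup.mk'_surjective M
    have hKgn : (K.map g).Normal := hKn.map g hg
    let h := QuotientGroup.mk' (K.map g)
    have hh : Function.Surjective h := QuotientGroup.mk'_surjective _
    let f := h.comp g
    have hf : Function.Surjective f := hh.comp hg
    have hker : f.ker = K ⊔ M := by
      rw [← MonoidHom.comap_ker, QuotientGroup.ker_mk', Subgroup.comap_map_eq,
        QuotientGroup.ker_mk']
    have hKf : K ≤ f.ker := hker ▸ le_sup_left
    have hinf : f.ker ⊓ L = K := by
      rcases hKL.eq_or_eq (f.ker ⊓ L) inferInstance (le_inf hKf hKL.lt.le) inf_le_right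
        with h | h
      · exact h
      · exact absurd (hker ▸ inf_eq_right.1 h) hLi
    have hR := hKL.map_of_ker_inf_eq hf hinf
    have hnorm : L.map f ≤ classNorm (GroupClass.piGroups πᶜ) F _ := by
      refine (Subgroup.map_mono hL).trans ?_
      rw [Subgroup.map_sup, (Subgroup.map_eq_bot_iff K).2 hKf, bot_sup_eq, ← Subgroup.map_map,
        classNormSeries_succ]
      exact (Subgroup.map_mono (Subgroup.map_comap_le _ _)).trans (hF.classNorm_map_le hS hh)
    have hres := hF.residual_map_of_surjective hS f hf
    have hcard : Nat.card (L.map f) = K.relIndex L := by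
      rw [← Subgroup.relIndex_ker, ← Subgroup.inf_relIndex_right, hinf]
    have hcomm := hR.commutator_residual_eq_bot hF hS
      (hres ▸ GroupClass.piSolvable_mem_map f hD) hnorm hp (hcard ▸ hpKL)
    rw [← hres, ← Subgroup.map_commutator, Subgroup.map_eq_bot_iff] at hcomm
    rw [← hinf]
    exact le_inf hcomm (Subgroup.commutator_le_right _ _)

theorem isPiHypercentral_classNormSeries (hF : F.IsFormation) (hS : F.IsSubgroupClosed)
    (hD : (GroupClass.piSolvable π).Mem (F.residual G)) (i : ℕ) :
    IsPiHypercentral π (GroupClass.formationProduct GroupClass.nilpotent F)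
      (classNormSeries (GroupClass.piGroups πᶜ) F G i) := by
  refine ⟨inferInstance, ?_⟩
  intro K L _ _ hKL hL hp
  obtain ⟨p, hp, hpd⟩ := hp
  rw [card_factorSubgroup] at hpd
  rw [hF.isFactorCentral_iff hS hKL]
  exact commutator_residual_le_of_le_classNormSeries hF hS hD hKL hp hpd i
    (hL.trans le_sup_right)

theorem IsPiHypercentral.le_classNormInfty (hF : F.IsFormation) (hS : F.IsSubgroupClosed)
    {N : Subgroup G}
    (hN : IsPiHypercentral π (GroupClass.formationProduct GroupClass.nilpotent F) N) :
    N ≤ classNormInfty (GroupClass.piGroups πᶜ) F G := by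
  obtain ⟨n, hn, hsucc⟩ := exists_classNormInfty_eq (G := G) (GroupClass.piGroups πᶜ) F
  rw [hn]
  by_contra hNM
  set M := classNormSeries (GroupClass.piGroups πᶜ) F G n with hM
  obtain ⟨L, ⟨hLn, hLN, hLM⟩, hmin⟩ :=
    (Set.toFinite {L : Subgroup G | L.Normal ∧ L ≤ N ∧ ¬ L ≤ M}).exists_minimal
      ⟨N, hN.1, le_rfl, hNM⟩
  have hKL : IsChiefFactor (M ⊓ L) L := by
    refine ⟨inferInstance, hLn, inf_lt_right.2 hLM, fun X hX hKX hXL => ?_⟩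
    by_cases hXM : X ≤ M
    · exact Or.inl (le_antisymm (le_inf hXM hXL) hKX)
    · exact Or.inr (le_antisymm hXL (hmin ⟨hX, hXL.trans hLN, hXM⟩ hXL))
  let g := QuotientGroup.mk' M
  have hg : Function.Surjective g := QuotientGroup.mk'_surjective M
  have hker : g.ker = M := QuotientGroup.ker_mk' M
  -- The series is stationary at `n`, so it suffices to put the image of `L` in the norm of G/M.
  refine hLM ?_
  rw [← hsucc, classNormSeries_succ, ← Subgroup.map_le_iff_le_comap]
  by_cases hp : ∃ p ∈ π, (p : ℕ) ∣ Nat.card (factorSubgroup (M ⊓ L) L)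
  · have hc := (hF.isFactorCentral_iff hS hKL).1 (hN.2 _ _ hKL hLN hp)
    refine hF.le_classNorm hS ?_
    rw [← hF.residual_map_of_surjective hS g hg, ← Subgroup.map_commutator,
      Subgroup.map_eq_bot_iff, hker]
    exact hc.trans inf_le_left
  · refine le_trans (GroupClass.le_radical_piGroups (hLn.map g hg) ?_) radical_le_classNorm
    rw [card_factorSubgroup, Subgroup.inf_relIndex_right] at hp
    rw [← Subgroup.relIndex_ker, hker]
    exact fun p hpd hpπ => hp ⟨p, hpπ, hpd⟩

end Series

theorem theoremD (π : Set Nat.Primes) (F : GroupClass.{u}) (hF : F.IsFormation)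
    (hS : F.IsSubgroupClosed) (G : Type u) [Group G]
    (hG : (GroupClass.formationProduct (GroupClass.piSolvable π) F).Mem G) :
    piNormInfty πᶜ F G =
      piHypercentre π (GroupClass.formationProduct GroupClass.nilpotent F) G := by
  have := hG.1
  refine le_antisymm ?_ (sSup_le fun N hN => IsPiHypercentral.le_classNormInfty hF hS hN)
  exact iSup_le fun i => le_sSup (isPiHypercentral_classNormSeries hF hS hG.2 i)
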